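/- Let $\mathsf V$ be a pseudovariety of finite semigroups (a class of finite semigroups closed under subsemigroups, homomorphic images and finite direct products). For a finite alphabet $X$, let $\overline{\Omega}_X\mathsf V$ be the free pro-$\mathsf V$ semigroup on $X$, that is, the projective limit of the quotients of the free semigroup $X^+$ that belong to $\mathsf V$. Let $\widehat{\mathbb N}$ be the profinite completion of $(\mathbb N,+)$; every $\alpha\in\widehat{\mathbb N}\setminus\mathbb N$ defines an operation $x\mapsto x^\alpha=\lim_k x^{a_k}$ on each $\overline{\Omega}_X\mathsf V$, where $(a_k)_k$ is any sequence of positive integers converging to $\alpha$ in $\widehat{\mathbb N}$. Let $\bar 1$ be the signature consisting of multiplication and all operations $x\mapsto x^\alpha$ with $\alpha\in\widehat{\mathbb N}\setminus\mathbb N$, and let $\kappa$ be the signature consisting of multiplication and the single operation $x\mapsto x^{\omega-1}=\lim_k x^{k!-1}$. For $\sigma\in\{\kappa,\bar 1\}$, the $\sigma$-words over $\mathsf V$ are the elements of the smallest subset of $\overline{\Omega}_X\mathsf V$ that contains $X$ and is closed under the operations of $\sigma$. The pseudovariety $\mathsf V$ is called $\sigma$-factorial if, for every finite alphabet $X$,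 every factor in $\overline{\Omega}_X\mathsf V$ of a $\sigma$-word over $\mathsf V$ is again a $\sigma$-word over $\mathsf V$; here $u$ is a factor of $w$ if $w=aub$ for some, possibly empty, $a,b$. For every positive integer $n$, let $\overline{\mathsf B_n}$ be the pseudovariety of all finite semigroups all of whose subgroups have exponent dividing $n$. Then $\overline{\mathsf B_n}$ is $\kappa$-factorial and, for every finite alphabet $X$, the $\kappa$-words over $\overline{\mathsf B_n}$ and the $\bar 1$-words over $\overline{\mathsf B_n}$ in $\overline{\Omega}_X\overline{\mathsf B_n}$ are the same elements. In particular, the pseudovariety $\mathsf A$ of all finite aperiodic semigroups (those whose subgroups are all trivial) is $\kappa$-factorial. -/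

import Mathlib

/-- `spow s m` is the power `s ^ (m + 1)` in a semigroup. -/
def spow {S : Type*} [Semigroup S] (s : S) : ℕ → S
  | 0 => s
  | m + 1 => spow s m * s

theorem spow_add {S : Type*} [Semigroup S] (s : S) (a b : ℕ) :
    spow s (a + b + 1) = spow s a * spow s b := by
  induction b with
  | zero => rfl
  | succ b ih =>
    change spow s (a + b + 1) * s = spow s a * (spow s b * s)
    rw [ih, mul_assoc]

theorem map_spow {S T : Type*} [Semigroup S] [Semigroup T] (f : S →ₙ* T) (s : S) (m : ℕ) :
    f (spow s m) = spow (f s) m := by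
  induction m with
  | zero => rfl
  | succ m ih => simp [spow, ih]

theorem spow_group {G : Type*} [Group G] (g : G) (m : ℕ) : spow g m = g ^ (m + 1) := by
  induction m with
  | zero => simp [spow]
  | succ m ih => rw [spow, ih, ← pow_succ]

/-- In a finite semigroup the powers of an element are ultimately periodic. -/
theorem spow_periodic {S : Type*} [Semigroup S] [Finite S] (s : S) :
    ∃ i p : ℕ, 0 < p ∧ ∀ m t : ℕ, i ≤ m → spow s (m + p * t) = spow s m := by
  obtain ⟨a, b, hab, h⟩ := Finite.exists_ne_map_eq_of_infinite (spow s)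
  have key : ∀ i p : ℕ, spow s (i + p) = spow s i →
      ∀ m t : ℕ, i ≤ m → spow s (m + p * t) = spow s m := by
    intro i p hp
    have step : ∀ m, i ≤ m → spow s (m + p) = spow s m := by
      intro m hm
      induction m, hm using Nat.le_induction with
      | base => exact hp
      | succ m _ ih =>
        rw [show m + 1 + p = (m + p) + 1 by omega]
        change spow s (m + p) * s = spow s m * s
        rw [ih]
    intro m t hm
    induction t with
    | zero => rfl
    | succ t ih =>
      rw [show m + p * (t + 1) = m + p * t + p by ring, step _ (by omega), ih]
  rcases lt_or_gt_of_ne hab with hlt | hlt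
  · exact ⟨a, b - a, by omega, key a (b - a) (by rw [show a + (b - a) = b by omega, h])⟩
  · exact ⟨b, a - b, by omega, key b (a - b) (by rw [show b + (a - b) = a by omega, h])⟩

/-- In a finite semigroup the sequence `s ^ (k! - 1)`, `k = 2, 3, …`, is eventually constant. -/
theorem spow_factorial_eventually {S : Type*} [Semigroup S] [Finite S] (s : S) :
    ∃ v : S, ∀ᶠ k : ℕ in Filter.atTop, spow s (Nat.factorial (k + 2) - 2) = v := by
  obtain ⟨i, p, hp, h⟩ := spow_periodic s
  refine ⟨spow s (Nat.factorial (i + p + 2) - 2), Filter.eventually_atTop.2 ⟨i + p, ?_⟩⟩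
  intro k hk
  have hi : i ≤ Nat.factorial (i + p + 2) - 2 := by
    have := Nat.self_le_factorial (i + p + 2)
    omega
  have hle : Nat.factorial (i + p + 2) ≤ Nat.factorial (k + 2) :=
    Nat.factorial_le (by omega)
  have h1 : p ∣ Nat.factorial (i + p + 2) := Nat.dvd_factorial hp (by omega)
  have h2 : p ∣ Nat.factorial (k + 2) := Nat.dvd_factorial hp (by omega)
  obtain ⟨t, ht⟩ := Nat.dvd_sub h2 h1
  have h3 := Nat.self_le_factorial (i + p + 2)
  rw [show Nat.factorial (k + 2) - 2 = Nat.factorial (i + p + 2) - 2 + p * t by omega]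
  exact h _ t hi

/-- A pseudovariety of finite semigroups: a class of finite semigroups closed under taking
subsemigroups, homomorphic images and finite direct products (the empty product being the
one-element semigroup). Closure under isomorphism is the case of a bijective homomorphism. -/
structure Pseudovariety where
  /-- Membership in the class. -/
  Mem : ∀ (S : Type) [Semigroup S], Prop
  finite : ∀ (S : Type) [Semigroup S], Mem S → Finite S
  sub : ∀ (S T : Type) [Semigroup S] [Semigroup T] (f : T →ₙ* S),
    Function.Injective f → Mem S → Mem T
  quot : ∀ (S T : Type) [Semigroup S] [Semigroup T] (f : S →ₙ* T),
    Function.Surjective f → Mem S → Mem T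
  unit : Mem PUnit
  prod : ∀ (S T : Type) [Semigroup S] [Semigroup T], Mem S → Mem T → Mem (S × T)

/-- All subgroups of the semigroup `S` belong to the class `H` of groups. A subgroup of a
semigroup is a subsemigroup that is a group, that is, the image of an injective semigroup
homomorphism from a group. -/
def SubgroupsIn (H : ∀ (G : Type) [Group G], Prop) (S : Type) [Semigroup S] : Prop :=
  ∀ (G : Type) [Group G] (f : G →ₙ* S), Function.Injective f → H G

/-- The invertible elements (together with their inverses) of the monoid `e S e`, for an
idempotent `e`. -/
structure LocalUnit {S : Type} [Semigroup S] (e : S) where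
  val : S
  inv : S
  one_mul : e * val = val
  mul_one : val * e = val
  one_mul_inv : e * inv = inv
  inv_mul_one : inv * e = inv
  val_inv : val * inv = e
  inv_val : inv * val = e

theorem LocalUnit.ext' {S : Type} [Semigroup S] {e : S} {u v : LocalUnit e}
    (h : u.val = v.val) : u = v := by
  have h2 : u.inv = v.inv := by
    calc u.inv = u.inv * (v.val * v.inv) := by rw [v.val_inv, u.inv_mul_one]
      _ = v.inv := by rw [← h, ← mul_assoc, u.inv_val, v.one_mul_inv]
  cases u
  cases v
  simp_all

/-- The group of units of `e S e`. -/
@[reducible] def LocalUnit.group {S : Type} [Semigroup S] (e : S) (he : e * e = e) :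
    Group (LocalUnit e) :=
  letI : Mul (LocalUnit e) := ⟨fun u v =>
    { val := u.val * v.val
      inv := v.inv * u.inv
      one_mul := by rw [← mul_assoc, u.one_mul]
      mul_one := by rw [mul_assoc, v.mul_one]
      one_mul_inv := by rw [← mul_assoc, v.one_mul_inv]
      inv_mul_one := by rw [mul_assoc, u.inv_mul_one]
      val_inv := by rw [mul_assoc, ← mul_assoc v.val, v.val_inv, u.one_mul_inv, u.val_inv]
      inv_val := by rw [mul_assoc, ← mul_assoc u.inv, u.inv_val, v.one_mul, v.inv_val] }⟩
  letI : Inv (LocalUnit e) := ⟨fun u => ⟨u.inv, u.val, u.one_mul_inv, u.inv_mul_one, u.one_mul,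
    u.mul_one, u.inv_val, u.val_inv⟩⟩
  letI : One (LocalUnit e) := ⟨⟨e, e, he, he, he, he, he, he⟩⟩
  Group.ofLeftAxioms (fun _ _ _ => LocalUnit.ext' (mul_assoc _ _ _))
    (fun u => LocalUnit.ext' u.one_mul) (fun u => LocalUnit.ext' u.inv_val)

/-- In a finite semigroup, all subgroups have exponent dividing `n` if and only if for every
element `s` the powers satisfy `s ^ (k + n) = s ^ k` for some `k ≥ 1`. -/
theorem subgroupsIn_exponent_iff (n : ℕ) (S : Type) [Semigroup S] [Finite S] :
    SubgroupsIn (fun G _ => Monoid.exponent G ∣ n) S ↔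
      ∀ s : S, ∃ k : ℕ, spow s (k + n) = spow s k := by
  constructor
  · intro h s
    obtain ⟨i, p, hp, hper⟩ := spow_periodic s
    obtain ⟨N, hN⟩ : ∃ N, p * (i + 2) = N + 2 := by
      refine ⟨p * (i + 2) - 2, ?_⟩
      have : 1 * (i + 2) ≤ p * (i + 2) := Nat.mul_le_mul_right _ hp
      omega
    have hiN : i ≤ N := by
      have : 1 * (i + 2) ≤ p * (i + 2) := Nat.mul_le_mul_right _ hp
      omega
    have hper1 : ∀ m, i ≤ m → spow s (m + (N + 2)) = spow s m := by
      intro m hm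
      rw [← hN]
      exact hper m _ hm
    have hprod : ∀ a b c, a + b + 1 = c → spow s a * spow s b = spow s c := by
      rintro a b c rfl
      exact (spow_add s a b).symm
    have he : spow s (N + 1) * spow s (N + 1) = spow s (N + 1) := by
      rw [hprod _ _ (N + 1 + (N + 2)) (by omega), hper1 _ (by omega)]
    let _ := LocalUnit.group (spow s (N + 1)) he
    let f : LocalUnit (spow s (N + 1)) →ₙ* S := ⟨LocalUnit.val, fun _ _ => rfl⟩
    have hf : Function.Injective f := fun _ _ hab => LocalUnit.ext' hab
    have hexp := h _ f hf
    let u : LocalUnit (spow s (N + 1)) :=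
      { val := spow s (N + 2)
        inv := spow s (N + (N + 2))
        one_mul := by rw [hprod _ _ (N + 2 + (N + 2)) (by omega), hper1 _ (by omega)]
        mul_one := by rw [hprod _ _ (N + 2 + (N + 2)) (by omega), hper1 _ (by omega)]
        one_mul_inv := by
          rw [hprod _ _ (N + (N + 2) + (N + 2)) (by omega), hper1 _ (by omega)]
        inv_mul_one := by
          rw [hprod _ _ (N + (N + 2) + (N + 2)) (by omega), hper1 _ (by omega)]
        val_inv := by
          rw [hprod _ _ (N + 1 + (N + 2) + (N + 2)) (by omega), hper1 _ (by omega),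
            hper1 _ (by omega)]
        inv_val := by
          rw [hprod _ _ (N + 1 + (N + 2) + (N + 2)) (by omega), hper1 _ (by omega),
            hper1 _ (by omega)] }
    have hun : u ^ n = 1 := by
      obtain ⟨t, rfl⟩ := hexp
      rw [pow_mul, Monoid.pow_exponent_eq_one, one_pow]
    have hval : ∀ m : ℕ, (u ^ m).val = spow s (N + 1 + m) := by
      intro m
      induction m with
      | zero => rfl
      | succ m ih =>
        rw [pow_succ]
        change (u ^ m).val * spow s (N + 2) = _
        rw [ih, hprod _ _ (N + 1 + (m + 1) + (N + 2)) (by omega), hper1 _ (by omega)]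
    refine ⟨N + 1, ?_⟩
    rw [← hval, hun]
    rfl
  · intro h G _ f hf
    apply Monoid.exponent_dvd_of_forall_pow_eq_one
    intro g
    obtain ⟨k, hk⟩ := h (f g)
    rw [← map_spow, ← map_spow] at hk
    have := hf hk
    rw [spow_group, spow_group, show k + n + 1 = (k + 1) + n by omega, pow_add] at this
    exact mul_eq_left.mp this

/-- The pseudovariety of all finite semigroups. -/
def allFinite : Pseudovariety where
  Mem S _ := Finite S
  finite _ _ h := h
  sub _ _ _ _ f hf _ := Finite.of_injective f hf
  quot _ _ _ _ f hf _ := Finite.of_surjective f hf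
  unit := inferInstance
  prod _ _ _ _ _ _ := inferInstance

/-- The pseudovariety of all finite semigroups whose subgroups have exponent dividing `n`. -/
def burnsideBar (n : ℕ) : Pseudovariety where
  Mem S _ := Finite S ∧ SubgroupsIn (fun G _ => Monoid.exponent G ∣ n) S
  finite _ _ h := h.1
  sub _ _ _ _ f hf h :=
    ⟨haveI := h.1; Finite.of_injective f hf, fun G _ g hg => h.2 G (f.comp g) (hf.comp hg)⟩
  quot S T _ _ f hf h := by
    have := h.1
    have := Finite.of_surjective f hf
    refine ⟨this, (subgroupsIn_exponent_iff n T).2 fun t => ?_⟩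
    obtain ⟨s, rfl⟩ := hf t
    obtain ⟨k, hk⟩ := (subgroupsIn_exponent_iff n S).1 h.2 s
    exact ⟨k, by rw [← map_spow, hk, map_spow]⟩
  unit := ⟨inferInstance, (subgroupsIn_exponent_iff n PUnit).2 fun _ => ⟨0, rfl⟩⟩
  prod S T _ _ hS hT := by
    have := hS.1
    have := hT.1
    refine ⟨inferInstance, fun G _ f hf => Monoid.exponent_dvd_of_forall_pow_eq_one ?_⟩
    have hmono : ∀ (R : Type) [Semigroup R] (r : R) (k j : ℕ), spow r (k + n) = spow r k →
        spow r (k + j + n) = spow r (k + j) := by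
      intro R _ r k j hk
      induction j with
      | zero => exact hk
      | succ j ih =>
        rw [show k + (j + 1) + n = (k + j + n) + 1 by omega]
        change spow r (k + j + n) * r = spow r (k + j) * r
        rw [ih]
    intro g
    obtain ⟨k, hk⟩ := (subgroupsIn_exponent_iff n S).1 hS.2 (f g).1
    obtain ⟨l, hl⟩ := (subgroupsIn_exponent_iff n T).1 hT.2 (f g).2
    have hk' := hmono S _ k l hk
    have hl' := hmono T _ l k hl
    rw [add_comm l k] at hl'
    have h1 : ∀ m, (spow (f g) m).1 = spow (f g).1 m := map_spow (MulHom.fst S T) (f g)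
    have h2 : ∀ m, (spow (f g) m).2 = spow (f g).2 m := map_spow (MulHom.snd S T) (f g)
    have h3 : spow (f g) (k + l + n) = spow (f g) (k + l) :=
      Prod.ext (by rw [h1, h1, hk']) (by rw [h2, h2, hl'])
    rw [← map_spow, ← map_spow] at h3
    have h4 := hf h3
    rw [spow_group, spow_group, show k + l + n + 1 = (k + l + 1) + n by omega, pow_add] at h4
    exact mul_eq_left.mp h4

theorem subgroupsIn_subsingleton_iff (S : Type) [Semigroup S] :
    (Finite S ∧ SubgroupsIn (fun G _ => Subsingleton G) S) ↔ (burnsideBar 1).Mem S := by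
  simp [burnsideBar, SubgroupsIn, Monoid.exp_eq_one_iff]

/-- The pseudovariety `A` of all finite aperiodic semigroups, that is, of the finite semigroups
all of whose subgroups are trivial. -/
def aperiodic : Pseudovariety where
  Mem S _ := Finite S ∧ SubgroupsIn (fun G _ => Subsingleton G) S
  finite _ _ h := h.1
  sub _ _ _ _ f hf h := (subgroupsIn_subsingleton_iff _).2
    ((burnsideBar 1).sub _ _ f hf ((subgroupsIn_subsingleton_iff _).1 h))
  quot _ _ _ _ f hf h := (subgroupsIn_subsingleton_iff _).2
    ((burnsideBar 1).quot _ _ f hf ((subgroupsIn_subsingleton_iff _).1 h))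
  unit := (subgroupsIn_subsingleton_iff _).2 (burnsideBar 1).unit
  prod _ _ _ _ hS hT := (subgroupsIn_subsingleton_iff _).2 ((burnsideBar 1).prod _ _
    ((subgroupsIn_subsingleton_iff _).1 hS) ((subgroupsIn_subsingleton_iff _).1 hT))

/-- The congruences on the free semigroup on `X` whose quotient lies in `V`. -/
abbrev VCon (V : Pseudovariety) (X : Type) : Type :=
  {c : Con (FreeSemigroup X) // V.Mem c.Quotient}

/-- The free pro-`V` semigroup on the alphabet `X`: the projective limit of the quotients of the
free semigroup on `X` that lie in `V`, that is, the subsemigroup of their product formed by the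
families that are compatible with the canonical projections `X⁺/c → X⁺/d` for `c ≤ d`. -/
def freePro (V : Pseudovariety) (X : Type) :
    Subsemigroup (∀ c : VCon V X, c.1.Quotient) where
  carrier := {x | ∀ c d : VCon V X, c.1 ≤ d.1 → ∀ w : FreeSemigroup X,
    x c = (w : c.1.Quotient) → x d = (w : d.1.Quotient)}
  mul_mem' := by
    intro x y hx hy c d hcd w hw
    obtain ⟨u, hu⟩ := Quotient.exists_rep (x c)
    obtain ⟨v, hv⟩ := Quotient.exists_rep (y c)
    have h1 := hx c d hcd u hu.symm
    have h2 := hy c d hcd v hv.symm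
    rw [Pi.mul_apply, h1, h2, ← Con.coe_mul, Con.eq]
    refine hcd ?_
    rw [← Con.eq, Con.coe_mul, ← hw, Pi.mul_apply]
    exact congrArg₂ (· * ·) hu hv

/-- The canonical homomorphism from the free semigroup to the free pro-`V` semigroup. -/
def ofWord (V : Pseudovariety) (X : Type) : FreeSemigroup X →ₙ* freePro V X where
  toFun w := ⟨fun c => (w : c.1.Quotient), fun c d hcd _ hv =>
    (Con.eq d.1).2 (hcd ((Con.eq c.1).1 hv))⟩
  map_mul' _ _ := rfl

/-- Implicit operations of arity one on finite semigroups: the elements of the free profinite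
semigroup on one generator `x`. They are the operations `x ↦ x ^ α`, where `α` runs over the
nonzero elements of the profinite completion of `(ℕ, +)`, and `x ^ α` with `α = m` a positive
integer is the word `x ⋯ x` of length `m`. -/
abbrev UnaryOp : Type := freePro allFinite Unit

/-- The congruence on the free semigroup on one generator given by evaluation at `t`; its
quotient is isomorphic to the subsemigroup generated by `t`. -/
def monogenicCon {T : Type} [Semigroup T] [Finite T] (t : T) : VCon allFinite Unit :=
  ⟨Con.ker (FreeSemigroup.lift fun _ : Unit => t),
    Finite.of_injective
      (fun q : (Con.ker (FreeSemigroup.lift fun _ : Unit => t)).Quotient =>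
        Con.liftOn q (FreeSemigroup.lift fun _ : Unit => t) fun _ _ h => h) fun a b =>
      Con.induction_on₂ a b fun _ _ h => (Con.eq _).2 h⟩

/-- The value `t ^ α` at an element `t` of a finite semigroup `T`: the value at `t` of any word
that represents `α` modulo the evaluation congruence of `t`. -/
def evalOp (α : UnaryOp) {T : Type} [Semigroup T] [Finite T] (t : T) : T :=
  Con.liftOn (α.1 (monogenicCon t)) (FreeSemigroup.lift fun _ : Unit => t) fun _ _ h => h

/-- The operation `x ↦ x ^ α` on the free pro-`V` semigroup: it acts on each finite quotient. -/
def proPow {V : Pseudovariety} {X : Type} (x : freePro V X) (α : UnaryOp) : freePro V X :=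
  ⟨fun c => haveI := V.finite _ c.2; evalOp α (x.1 c), by
    intro c d hcd w hw
    have := V.finite _ c.2
    have := V.finite _ d.2
    obtain ⟨u, hu⟩ := Quotient.exists_rep (x.1 c)
    replace hu : x.1 c = (u : c.1.Quotient) := hu.symm
    have hu' := x.2 c d hcd u hu
    have hlift : ∀ (b : VCon V X) (v : FreeSemigroup Unit),
        FreeSemigroup.lift (fun _ : Unit => (u : b.1.Quotient)) v =
          ((FreeSemigroup.lift (fun _ : Unit => u) v : FreeSemigroup X) : b.1.Quotient) := by
      intro b v
      induction v with
      | ih1 a => rfl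
      | ih2 a v h1 h2 => rw [map_mul, h1, h2, map_mul, Con.coe_mul]
    obtain ⟨v, hv⟩ := Quotient.exists_rep (α.1 (monogenicCon (x.1 c)))
    replace hv : α.1 (monogenicCon (x.1 c)) = (v : (monogenicCon (x.1 c)).1.Quotient) := hv.symm
    have hle : (monogenicCon (x.1 c)).1 ≤ (monogenicCon (x.1 d)).1 := by
      intro a b hab
      change FreeSemigroup.lift (fun _ : Unit => x.1 c) a =
        FreeSemigroup.lift (fun _ : Unit => x.1 c) b at hab
      change FreeSemigroup.lift (fun _ : Unit => x.1 d) a =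
        FreeSemigroup.lift (fun _ : Unit => x.1 d) b
      rw [hu, hlift, hlift, Con.eq] at hab
      rw [hu', hlift, hlift, Con.eq]
      exact hcd hab
    have hv' := α.2 _ _ hle v hv
    have h1 : evalOp α (x.1 c) = FreeSemigroup.lift (fun _ : Unit => x.1 c) v := by
      rw [evalOp, hv]; rfl
    have h2 : evalOp α (x.1 d) = FreeSemigroup.lift (fun _ : Unit => x.1 d) v := by
      rw [evalOp, hv']; rfl
    change evalOp α (x.1 c) = _ at hw
    change evalOp α (x.1 d) = _
    rw [h1, hu, hlift, Con.eq] at hw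
    rw [h2, hu', hlift, Con.eq]
    exact hcd hw⟩

/-- The operation `x ^ (ω - 1)`, the limit of the words `x ^ (k! - 1)`: its component in each
finite quotient is the eventually constant value of that sequence. -/
noncomputable def omegaPred : UnaryOp :=
  ⟨fun c => haveI : Finite c.1.Quotient := c.2
    (spow_factorial_eventually ((FreeSemigroup.of () : FreeSemigroup Unit) : c.1.Quotient)).choose,
  by
    intro c d hcd w hw
    have : Finite c.1.Quotient := c.2
    have : Finite d.1.Quotient := d.2
    have hc := (spow_factorial_eventually
      ((FreeSemigroup.of () : FreeSemigroup Unit) : c.1.Quotient)).choose_spec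
    have hd := (spow_factorial_eventually
      ((FreeSemigroup.of () : FreeSemigroup Unit) : d.1.Quotient)).choose_spec
    obtain ⟨k, hk1, hk2⟩ := (hc.and hd).exists
    have hmk : ∀ (b : VCon allFinite Unit) (m : ℕ),
        spow ((FreeSemigroup.of () : FreeSemigroup Unit) : b.1.Quotient) m =
          ((spow (FreeSemigroup.of ()) m : FreeSemigroup Unit) : b.1.Quotient) :=
      fun b m => (map_spow (⟨fun v => (v : b.1.Quotient), fun _ _ => rfl⟩ :
        FreeSemigroup Unit →ₙ* b.1.Quotient) _ m).symm
    rw [hmk] at hk1 hk2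
    refine hk2.symm.trans ((Con.eq _).2 (hcd ((Con.eq _).1 ?_)))
    exact hk1.trans hw⟩

/-- A unary implicit signature, given by its set of exponents; multiplication is always part of
the signature. -/
abbrev UnarySignature : Type := Set UnaryOp

/-- The signature `κ`, with the only exponent `ω - 1`. -/
noncomputable def kappa : UnarySignature := {omegaPred}

/-- The signature `1̄` of all operations `x ^ α` with `α` infinite. -/
def oneBar : UnarySignature := {α | α ∉ Set.range (ofWord allFinite Unit)}

/-- The `σ`-words over `V`: the elements of the smallest subset of the free pro-`V` semigroup on
`X` that contains `X` and is closed under multiplication and the operations of `σ`. -/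
inductive IsSigmaWord (V : Pseudovariety) (σ : UnarySignature) (X : Type) :
    freePro V X → Prop
  | of (a : X) : IsSigmaWord V σ X (ofWord V X (FreeSemigroup.of a))
  | mul (x y : freePro V X) :
      IsSigmaWord V σ X x → IsSigmaWord V σ X y → IsSigmaWord V σ X (x * y)
  | pow (x : freePro V X) (α : UnaryOp) :
      α ∈ σ → IsSigmaWord V σ X x → IsSigmaWord V σ X (proPow x α)

/-- `u` is a factor of `w` in the semigroup `S`: `w = a u b` with `a` and `b` possibly empty. -/
def IsFactor {S : Type*} [Semigroup S] (u w : S) : Prop :=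
  w = u ∨ (∃ a, w = a * u) ∨ (∃ b, w = u * b) ∨ ∃ a b, w = a * u * b

/-- `V` is `σ`-factorial: for every finite alphabet `X`, every factor of a `σ`-word over `V` in
the free pro-`V` semigroup on `X` is a `σ`-word over `V`. -/
def IsFactorial (V : Pseudovariety) (σ : UnarySignature) : Prop :=
  ∀ (X : Type) [Finite X] (u w : freePro V X),
    IsSigmaWord V σ X w → IsFactor u w → IsSigmaWord V σ X u

open Filter


/-! ### Cuts of words: products and powers in a free semigroup. -/

namespace FreeSemigroup

/-! Two facts about V = `burnsideBar n` carry the proof.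

First, factorizations lift to words. If X⁺/c lies in V, so does X⁺/`splitCon c`, where two words are
identified when they agree modulo c and have the same cuts modulo c (`burnsideBar_splitCon`). So if
w = x * y, any word representing w modulo `splitCon c` is literally a product of words representing
x and y modulo c (`exists_factorization`). Elements of the free pro-V semigroup are treated as
limits of words along one ultrafilter of ever finer congruences. An induction on the construction of
a κ-word then reduces to cutting a concrete product or power of words. The ultrafilter selects one
position of the cut, and the pieces converge to elements covered by the induction hypothesis or to
limits of powers (`IsSigmaWord.of_eq_mul`).

Second, in a member of V, large powers of an element depend only on the exponent modulo n. Hence a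
limit of powers of words converging to z is either a finite power of z or z ^ (ω + r + 1) with r <
n, a κ-word in z (`IsSigmaWord.of_isLim_spow`). This handles the powers left by a cut. It also makes
every z ^ α a κ-word in z, which gives the comparison with `oneBar`; conversely ω - 1 is infinite.
The aperiodic case is n = 1. -/

theorem mul_eq_mul_iff_exists {X : Type*} {a b c d : FreeSemigroup X} (h : a * b = c * d) :
    (a = c ∧ b = d) ∨ (∃ t, a = c * t ∧ d = t * b) ∨ ∃ t, c = a * t ∧ b = t * d := by
  obtain ⟨ah, at'⟩ := a
  obtain ⟨bh, bt⟩ := b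
  obtain ⟨ch, ct⟩ := c
  obtain ⟨dh, dt⟩ := d
  simp only [FreeSemigroup.mk_mul_mk, FreeSemigroup.mk.injEq] at h
  obtain ⟨rfl, h⟩ := h
  rcases List.append_eq_append_iff.1 h with ⟨s, h1, h2⟩ | ⟨s, h1, h2⟩
  · cases s with
    | nil => left; simp_all
    | cons x s =>
      right; right
      refine ⟨⟨x, s⟩, ?_, ?_⟩ <;> simp_all [FreeSemigroup.mk_mul_mk]
  · cases s with
    | nil => left; simp_all
    | cons x s =>
      right; left
      refine ⟨⟨x, s⟩, ?_, ?_⟩ <;> simp_all [FreeSemigroup.mk_mul_mk]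

theorem of_ne_mul {X : Type*} (a : X) (u v : FreeSemigroup X) : of a ≠ u * v := by
  intro h
  have := congrArg length h
  simp only [length_of, length_mul] at this
  have h1 : 0 < u.length := Nat.succ_pos _
  have h2 : 0 < v.length := Nat.succ_pos _
  omega

/-- A proper prefix of a power. -/
theorem prefix_spow {X : Type*} {z a b : FreeSemigroup X} {m : ℕ} (h : spow z m = a * b) :
    (∃ r, a = spow z r) ∨ (∃ p q, p * q = z ∧ a = p) ∨
      ∃ r p q, p * q = z ∧ a = spow z r * p := by
  induction m generalizing a b with
  | zero => exact .inr (.inl ⟨a, b, h.symm, rfl⟩)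
  | succ m ih =>
    rcases mul_eq_mul_iff_exists (show spow z m * z = a * b from h) with
      ⟨rfl, rfl⟩ | ⟨t, h1, rfl⟩ | ⟨t, rfl, h2⟩
    · exact .inl ⟨m, rfl⟩
    · exact ih h1
    · exact .inr (.inr ⟨m, t, b, h2.symm, rfl⟩)

theorem spow_succ_left {S : Type*} [Semigroup S] (s : S) (m : ℕ) :
    spow s (m + 1) = s * spow s m := by
  have := spow_add s 0 m
  rwa [zero_add] at this

/-- A proper suffix of a power. -/
theorem suffix_spow {X : Type*} {z a b : FreeSemigroup X} {m : ℕ} (h : spow z m = a * b) :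
    (∃ r, b = spow z r) ∨ (∃ p q, p * q = z ∧ b = q) ∨
      ∃ r p q, p * q = z ∧ b = q * spow z r := by
  induction m generalizing a b with
  | zero => exact .inr (.inl ⟨a, b, h.symm, rfl⟩)
  | succ m ih =>
    rcases mul_eq_mul_iff_exists ((spow_succ_left z m).symm.trans h) with
      ⟨rfl, rfl⟩ | ⟨t, h1, rfl⟩ | ⟨t, rfl, h2⟩
    · exact .inl ⟨m, rfl⟩
    · exact .inr (.inr ⟨m, a, t, h1.symm, rfl⟩)
    · exact ih h2

theorem lift_unit_eq_spow {S : Type*} [Semigroup S] (v : FreeSemigroup Unit) (s : S) :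
    lift (fun _ : Unit => s) v = spow s v.tail.length := by
  induction v with
  | ih1 a => rfl
  | ih2 a v _ h =>
    rw [map_mul, h, lift_of, ← spow_succ_left]
    rfl

end FreeSemigroup

/-! ### The cut congruence and closure of `burnsideBar n` under it. -/

section Split

variable {X : Type}

/-- Every cut of `u` is matched by a cut of `v` modulo `c`. -/
def CutLE (c : Con (FreeSemigroup X)) (u v : FreeSemigroup X) : Prop :=
  ∀ u₁ u₂, u = u₁ * u₂ → ∃ v₁ v₂, v = v₁ * v₂ ∧ c u₁ v₁ ∧ c u₂ v₂

/-- A cut of a product falls at the joint or inside one of the two factors; the factor that is not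
cut is replaced as a whole. -/
theorem CutLE.mul {c : Con (FreeSemigroup X)} {u v u' v' : FreeSemigroup X} (hc : c u v)
    (hc' : c u' v') (h : CutLE c u v) (h' : CutLE c u' v') : CutLE c (u * u') (v * v') := by
  intro a b hab
  rcases FreeSemigroup.mul_eq_mul_iff_exists hab with
    ⟨rfl, rfl⟩ | ⟨t, rfl, rfl⟩ | ⟨t, rfl, rfl⟩
  · exact ⟨v, v', rfl, hc, hc'⟩
  · obtain ⟨p, q, rfl, h1, h2⟩ := h _ _ rfl
    exact ⟨p, q * v', mul_assoc _ _ _, h1, c.mul h2 hc'⟩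
  · obtain ⟨p, q, rfl, h1, h2⟩ := h' _ _ rfl
    exact ⟨v * p, q, (mul_assoc _ _ _).symm, c.mul hc h1, h2⟩

/-- The congruence that identifies words which are congruent modulo `c` and have the same cuts
modulo `c`. Its quotient is a subsemigroup of the Schützenberger product. -/
def splitCon (c : Con (FreeSemigroup X)) : Con (FreeSemigroup X) where
  r u v := c u v ∧ CutLE c u v ∧ CutLE c v u
  iseqv :=
    { refl := fun u => ⟨c.refl u, fun a b h => ⟨a, b, h, c.refl a, c.refl b⟩,
        fun a b h => ⟨a, b, h, c.refl a, c.refl b⟩⟩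
      symm := fun h => ⟨c.symm h.1, h.2.2, h.2.1⟩
      trans := by
        have key : ∀ {u v w}, CutLE c u v → CutLE c v w → CutLE c u w := by
          intro u v w h h' a b hab
          obtain ⟨p, q, hpq, h1, h2⟩ := h a b hab
          obtain ⟨p', q', hpq', h1', h2'⟩ := h' p q hpq
          exact ⟨p', q', hpq', c.trans h1 h1', c.trans h2 h2'⟩
        exact fun {_ _ _} h h' => ⟨c.trans h.1 h'.1, key h.2.1 h'.2.1, key h'.2.2 h.2.2⟩ }
  mul' h h' := ⟨c.mul h.1 h'.1, h.2.1.mul h.1 h'.1 h'.2.1,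
    h.2.2.mul (c.symm h.1) (c.symm h'.1) h'.2.2⟩

theorem splitCon_le (c : Con (FreeSemigroup X)) : splitCon c ≤ c := fun _ _ h => h.1

instance finite_splitCon (c : Con (FreeSemigroup X)) [Finite c.Quotient] :
    Finite (splitCon c).Quotient := by
  let f : FreeSemigroup X → c.Quotient × Set (c.Quotient × c.Quotient) := fun u =>
    (u, {p | ∃ a b : FreeSemigroup X, u = a * b ∧ p = (↑a, ↑b)})
  have hf : ∀ u v, f u = f v → splitCon c u v := by
    have key : ∀ u v, f u = f v → CutLE c u v := by
      intro u v h a b hab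
      have : ((a : c.Quotient), (b : c.Quotient)) ∈ (f v).2 := h ▸ ⟨a, b, hab, rfl⟩
      obtain ⟨a', b', h1, h2⟩ := this
      rw [Prod.mk.injEq, Con.eq, Con.eq] at h2
      exact ⟨a', b', h1, h2.1, h2.2⟩
    exact fun u v h => ⟨(Con.eq c).1 (congrArg Prod.fst h), key u v h, key v u h.symm⟩
  refine Finite.of_injective (fun q : (splitCon c).Quotient => f q.out) fun p q h => ?_
  rw [← Quotient.out_eq p, ← Quotient.out_eq q]
  exact Quotient.sound (hf _ _ h)

theorem coe_spow (c : Con (FreeSemigroup X)) (u : FreeSemigroup X) (m : ℕ) :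
    ((spow u m : FreeSemigroup X) : c.Quotient) = spow (u : c.Quotient) m :=
  map_spow (⟨fun v => (v : c.Quotient), fun _ _ => rfl⟩ : FreeSemigroup X →ₙ* c.Quotient) u m

theorem spow_add_period {S : Type*} [Semigroup S] {s : S} {k n : ℕ}
    (h : spow s (k + n) = spow s k) {m : ℕ} (hm : k ≤ m) : spow s (m + n) = spow s m := by
  induction m, hm using Nat.le_induction with
  | base => exact h
  | succ m _ ih =>
    rw [show m + 1 + n = (m + n) + 1 by omega]
    exact congrArg (· * s) ih

theorem spow_eq_of_modEq {S : Type*} [Semigroup S] {s : S} {k n : ℕ}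
    (h : spow s (k + n) = spow s k) {a b : ℕ} (ha : k ≤ a) (hb : k ≤ b) (hab : a ≡ b [MOD n]) :
    spow s a = spow s b := by
  have key : ∀ m t, k ≤ m → spow s (m + n * t) = spow s m := by
    intro m t hm
    induction t with
    | zero => rfl
    | succ t ih =>
      rw [Nat.mul_succ, ← Nat.add_assoc, spow_add_period h (by omega), ih]
  have main : ∀ a b, k ≤ a → a ≤ b → a ≡ b [MOD n] → spow s a = spow s b := by
    intro a b ha hle hab
    obtain ⟨t, ht⟩ := (Nat.modEq_iff_dvd' hle).1 hab
    rw [show b = a + n * t by omega, key _ _ ha]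
  rcases le_total a b with hle | hle
  · exact main a b ha hle hab
  · exact (main b a hb hle hab.symm).symm

/-- The word `spow u e` is long enough to contain a second copy of `spow u i`. Whichever of two
disjoint copies the cut avoids can be exchanged for `spow u j`, on one side of the cut only. -/
theorem cutLE_spow {c : Con (FreeSemigroup X)} {u : FreeSemigroup X} {i j e : ℕ}
    (h : c (spow u i) (spow u j)) (he : i + 1 ≤ e) :
    CutLE c (spow u (i + e + 1)) (spow u (j + e + 1)) := by
  obtain ⟨d, rfl⟩ : ∃ d, e = d + i + 1 := ⟨e - (i + 1), by omega⟩
  have hj : spow u (j + (d + i + 1) + 1) = spow u (d + i + 1) * spow u j := by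
    rw [← spow_add]; congr 1; omega
  intro a b hab
  rw [spow_add] at hab
  rcases FreeSemigroup.mul_eq_mul_iff_exists hab with ⟨rfl, rfl⟩ | ⟨t, ht, rfl⟩ | ⟨t, rfl, ht⟩
  · exact ⟨_, _, spow_add _ _ _, h, c.refl _⟩
  -- The cut lies in the leading copy of `spow u i`, so the trailing copy is the one exchanged.
  · refine ⟨a, t * spow u d * spow u j, ?_, c.refl a, ?_⟩
    · rw [← mul_assoc, ← mul_assoc, ← ht, ← spow_add, ← spow_add]; congr 1; omega
    · rw [spow_add, ← mul_assoc]; exact c.mul (c.refl _) h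
  · exact ⟨spow u j * t, b, by rw [mul_assoc, ← ht, ← spow_add], c.mul h (c.refl t), c.refl b⟩

theorem burnsideBar_splitCon {n : ℕ} {c : Con (FreeSemigroup X)}
    (h : (burnsideBar n).Mem c.Quotient) : (burnsideBar n).Mem (splitCon c).Quotient := by
  have := h.1
  refine ⟨inferInstance, (subgroupsIn_exponent_iff n _).2 fun s => ?_⟩
  induction s using Con.induction_on with | _ u =>
  obtain ⟨K, hK⟩ := (subgroupsIn_exponent_iff n _).1 h.2 (u : c.Quotient)
  have hKc : c (spow u (K + n)) (spow u K) := by rw [← Con.eq, coe_spow, coe_spow, hK]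
  -- The extra factor `spow u (K + n + 1)` is long enough for `cutLE_spow` in both directions, with
  -- i = K + n and with i = K.
  refine ⟨K + (K + n + 1) + 1, ?_⟩
  rw [← coe_spow, ← coe_spow, Con.eq,
    show K + (K + n + 1) + 1 + n = K + n + (K + n + 1) + 1 by omega]
  refine ⟨?_, cutLE_spow hKc le_rfl, cutLE_spow (c.symm hKc) (by omega)⟩
  rw [spow_add u (K + n) (K + n + 1), spow_add u K (K + n + 1)]
  exact c.mul hKc (c.refl _)

end Split

/-! ### Elements of the free pro-V semigroup as ultrafilter limits of words. -/

section Limits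

variable {V : Pseudovariety} {X : Type}

instance nonempty_vCon : Nonempty (VCon V X) := by
  have : Subsingleton (⊤ : Con (FreeSemigroup X)).Quotient :=
    ⟨fun a b => Con.induction_on₂ a b fun _ _ => (Con.eq _).2 trivial⟩
  refine ⟨⟨⊤, V.sub PUnit _ ⟨fun _ => PUnit.unit, fun _ _ => rfl⟩ (fun a b _ => ?_) V.unit⟩⟩
  exact Subsingleton.elim a b

/-- Together with nonemptiness this makes `atBot` a proper filter, so that an ultrafilter below it
exists. The lower bound is the intersection, whose quotient embeds in the product. -/
instance isCodirected_vCon : IsCodirectedOrder (VCon V X) where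
  directed c d := by
    let f : (c.1 ⊓ d.1).Quotient →ₙ* c.1.Quotient × d.1.Quotient :=
      { toFun := fun q => Con.liftOn q (fun w => ((w : c.1.Quotient), (w : d.1.Quotient)))
          fun a b h => Prod.ext ((Con.eq _).2 h.1) ((Con.eq _).2 h.2)
        map_mul' := fun a b => Con.induction_on₂ a b fun _ _ => rfl }
    have hf : Function.Injective f := by
      intro a b
      refine Con.induction_on₂ a b fun u v h => ?_
      have h' := Prod.mk.inj h
      exact (Con.eq _).2 ⟨(Con.eq _).1 h'.1, (Con.eq _).1 h'.2⟩
    exact ⟨⟨c.1 ⊓ d.1, V.sub _ _ f hf (V.prod _ _ c.2 d.2)⟩,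
      fun _ _ h => h.1, fun _ _ h => h.2⟩

variable (V X) in
/-- An ultrafilter on the congruences that define the free pro-`V` semigroup, converging to the
finest ones. -/
noncomputable def fineUltrafilter : Ultrafilter (VCon V X) := Ultrafilter.of atBot

theorem eventually_le_fine (c : VCon V X) : ∀ᶠ d in (fineUltrafilter V X : Filter _), d ≤ c :=
  Ultrafilter.of_le atBot (eventually_le_atBot c)

/-- The family of words `f` converges to `x` along the ultrafilter `fineUltrafilter`. -/
def IsLim (f : VCon V X → FreeSemigroup X) (x : freePro V X) : Prop :=
  ∀ c : VCon V X, ∀ᶠ i in (fineUltrafilter V X : Filter _), (f i : c.1.Quotient) = x.1 c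

/-- An ultrafilter partitioned into finitely many pieces selects one of them. -/
theorem exists_eventually_eq {ι α : Type*} [Finite α] (l : Ultrafilter ι) (f : ι → α) :
    ∃ a, ∀ᶠ i in (l : Filter ι), f i = a := by
  obtain ⟨a, ha⟩ := (l.map f).eq_pure_of_finite
  refine ⟨a, ?_⟩
  have : ({a} : Set α) ∈ l.map f := by rw [ha]; exact rfl
  exact this

/-- Compactness: each quotient is finite, so the ultrafilter picks one class in it, and these
classes are compatible. -/
theorem exists_isLim (f : VCon V X → FreeSemigroup X) : ∃ x, IsLim f x := by
  have h : ∀ c : VCon V X, ∃ q : c.1.Quotient,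
      ∀ᶠ i in (fineUltrafilter V X : Filter _), (f i : c.1.Quotient) = q := fun c =>
    haveI := V.finite _ c.2
    exists_eventually_eq _ _
  choose q hq using h
  refine ⟨⟨q, fun c d hcd w hw => ?_⟩, hq⟩
  obtain ⟨i, h1, h2⟩ := ((hq c).and (hq d)).exists
  rw [← h2, Con.eq]
  rw [hw, Con.eq] at h1
  exact hcd h1

theorem IsLim.unique {f : VCon V X → FreeSemigroup X} {x y : freePro V X} (hx : IsLim f x)
    (hy : IsLim f y) : x = y := by
  refine Subtype.ext (funext fun c => ?_)
  obtain ⟨i, h1, h2⟩ := ((hx c).and (hy c)).exists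
  exact h1.symm.trans h2

theorem IsLim.congr {f g : VCon V X → FreeSemigroup X} {x : freePro V X} (hx : IsLim f x)
    (h : ∀ᶠ i in (fineUltrafilter V X : Filter _), f i = g i) : IsLim g x := fun c => by
  filter_upwards [hx c, h] with i h1 h2
  rw [← h2, h1]

theorem IsLim.mul {f g : VCon V X → FreeSemigroup X} {x y : freePro V X} (hx : IsLim f x)
    (hy : IsLim g y) : IsLim (fun i => f i * g i) (x * y) := fun c => by
  filter_upwards [hx c, hy c] with i h1 h2
  rw [Con.coe_mul, h1, h2]
  rfl

theorem coe_spow_freePro (x : freePro V X) (m : ℕ) (c : VCon V X) :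
    (spow x m).1 c = spow (x.1 c) m :=
  map_spow (⟨fun y => y.1 c, fun _ _ => rfl⟩ : freePro V X →ₙ* c.1.Quotient) x m

theorem IsLim.spow {f : VCon V X → FreeSemigroup X} {x : freePro V X} (hx : IsLim f x) (m : ℕ) :
    IsLim (fun i => spow (f i) m) (spow x m) := fun c => by
  filter_upwards [hx c] with i h1
  rw [coe_spow, h1, coe_spow_freePro]

/-- For fixed c the ultrafilter eventually sees i ≤ c, hence g i ≤ c, and agreement modulo g i
descends to c. With g = `splitCon`, representatives chosen modulo the finer congruence still
converge. -/
theorem IsLim.of_le {g : VCon V X → VCon V X} (hg : ∀ c, g c ≤ c)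
    {f : VCon V X → FreeSemigroup X} {x : freePro V X}
    (h : ∀ c, (f c : (g c).1.Quotient) = x.1 (g c)) : IsLim f x := fun c => by
  filter_upwards [eventually_le_fine c] with i hi
  exact (x.2 (g i) c ((hg i).trans hi) (f i) (h i).symm).symm

theorem exists_coe_eq (x : freePro V X) (c : VCon V X) :
    ∃ w : FreeSemigroup X, (w : c.1.Quotient) = x.1 c :=
  Quotient.exists_rep (x.1 c)

theorem evalOp_eq_spow {α : UnaryOp} {T : Type} [Semigroup T] [Finite T] (t : T) :
    ∃ m, evalOp α t = spow t m := by
  obtain ⟨v, hv⟩ := exists_coe_eq α (monogenicCon t)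
  refine ⟨v.tail.length, ?_⟩
  rw [← FreeSemigroup.lift_unit_eq_spow, evalOp, ← hv]
  rfl

theorem proPow_eq_spow (x : freePro V X) (α : UnaryOp) (c : VCon V X) :
    ∃ m, (proPow x α).1 c = spow (x.1 c) m :=
  haveI := V.finite _ c.2
  evalOp_eq_spow _

theorem evalOp_omegaPred {T : Type} [Semigroup T] [Finite T] (t : T) :
    ∀ᶠ k : ℕ in atTop, evalOp omegaPred t = spow t (Nat.factorial (k + 2) - 2) := by
  have : Finite (monogenicCon t).1.Quotient := (monogenicCon t).2
  filter_upwards [(spow_factorial_eventually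
    ((FreeSemigroup.of () : FreeSemigroup Unit) : (monogenicCon t).1.Quotient)).choose_spec]
    with k hk
  have h : omegaPred.1 (monogenicCon t) = _ := hk.symm
  rw [← coe_spow] at h
  rw [evalOp, h]
  exact map_spow (FreeSemigroup.lift fun _ : Unit => t) _ _

end Limits

/-! ### Limits of powers, and factors of κ-words. -/

section Words

variable {X : Type} {n : ℕ}

theorem IsSigmaWord.spow {V : Pseudovariety} {σ : UnarySignature} {z : freePro V X}
    (hz : IsSigmaWord V σ X z) (m : ℕ) : IsSigmaWord V σ X (spow z m) := by
  induction m with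
  | zero => exact hz
  | succ m ih => exact .mul _ _ ih hz

/-- A limit of unbounded powers of `z`, with exponents `m i + 1` where `m i` is congruent to `r`
modulo `n`, is `z ^ (ω + r + 1)`. -/
theorem IsLim.eq_proPow_mul {z x : freePro (burnsideBar n) X}
    {f : VCon (burnsideBar n) X → FreeSemigroup X} {m : VCon (burnsideBar n) X → ℕ}
    (hn : 0 < n) (hf : IsLim f z) (hx : IsLim (fun i => _root_.spow (f i) (m i)) x)
    (hm : ∀ N, ∀ᶠ i in (fineUltrafilter (burnsideBar n) X : Filter _), N ≤ m i) {r : ℕ}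
    (hr : ∀ᶠ i in (fineUltrafilter (burnsideBar n) X : Filter _), m i % n = r) :
    x = proPow z omegaPred * z * _root_.spow z r := by
  refine Subtype.ext (funext fun c => ?_)
  have := c.2.1
  obtain ⟨K, hK⟩ := (subgroupsIn_exponent_iff n _).1 c.2.2 (z.1 c)
  obtain ⟨i, ⟨⟨hi1, hi2⟩, hi3⟩, hi4⟩ := (((hf c).and (hx c)).and (hm K)).and hr |>.exists
  -- The bound K + n puts (k + 2)! beyond the threshold K and makes it divisible by n, so the
  -- exponent (k + 2)! + r may be compared with `m i` modulo n.
  obtain ⟨k, hk1, hk2⟩ := ((evalOp_omegaPred (z.1 c)).and (eventually_ge_atTop (K + n))).exists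
  have hfac := Nat.self_le_factorial (k + 2)
  have hdvd : n ∣ Nat.factorial (k + 2) := Nat.dvd_factorial hn (by omega)
  have hval : (proPow z omegaPred * z * _root_.spow z r).1 c =
      evalOp omegaPred (z.1 c) * z.1 c * _root_.spow (z.1 c) r := by
    rw [← coe_spow_freePro]; rfl
  rw [← hi2, coe_spow, hi1, hval, hk1]
  change _ = _root_.spow (z.1 c) (Nat.factorial (k + 2) - 2 + 1) * _
  rw [← spow_add, show Nat.factorial (k + 2) - 2 + 1 + r + 1 = Nat.factorial (k + 2) + r by omega]
  refine spow_eq_of_modEq hK hi3 (by omega) ?_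
  have h0 : Nat.factorial (k + 2) ≡ 0 [MOD n] := (Nat.modEq_zero_iff_dvd).2 hdvd
  have h1 : m i ≡ r [MOD n] := by
    rw [← hi4]; exact (Nat.mod_modEq _ _).symm
  have h2 := (h0.add_right r).symm
  rw [zero_add] at h2
  exact h1.trans h2

theorem IsSigmaWord.of_isLim_spow {z x : freePro (burnsideBar n) X}
    {f : VCon (burnsideBar n) X → FreeSemigroup X} {m : VCon (burnsideBar n) X → ℕ}
    (hn : 0 < n) (hz : IsSigmaWord (burnsideBar n) kappa X z) (hf : IsLim f z)
    (hx : IsLim (fun i => _root_.spow (f i) (m i)) x) :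
    IsSigmaWord (burnsideBar n) kappa X x := by
  by_cases h : ∃ N, ∀ᶠ i in (fineUltrafilter (burnsideBar n) X : Filter _), m i = N
  · obtain ⟨N, hN⟩ := h
    have h1 := hx.congr (g := fun i => _root_.spow (f i) N) (hN.mono fun i hi => by rw [hi])
    rw [h1.unique (hf.spow N)]
    exact hz.spow N
  -- Along an ultrafilter, exponents that are not eventually constant exceed every bound.
  · have hm : ∀ N, ∀ᶠ i in (fineUltrafilter (burnsideBar n) X : Filter _), N ≤ m i := by
      intro N
      induction N with
      | zero => exact .of_forall fun i => Nat.zero_le _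
      | succ N ih =>
        have h1 := Ultrafilter.eventually_not.2 (not_exists.1 h N)
        filter_upwards [ih, h1] with i h2 h3
        omega
    obtain ⟨r, hr⟩ := exists_eventually_eq (fineUltrafilter (burnsideBar n) X)
      fun i => (⟨m i % n, Nat.mod_lt _ hn⟩ : Fin n)
    rw [hf.eq_proPow_mul hn hx hm (r := r) (hr.mono fun i hi => congrArg Fin.val hi)]
    exact .mul _ _ (.mul _ _ (.pow _ _ rfl hz) hz) (hz.spow _)

/-- In each finite quotient z ^ α is an ordinary power, so z ^ α is a limit of powers of words
converging to z, whatever α is. -/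
theorem IsSigmaWord.proPow {z : freePro (burnsideBar n) X} (hn : 0 < n)
    (hz : IsSigmaWord (burnsideBar n) kappa X z) (α : UnaryOp) :
    IsSigmaWord (burnsideBar n) kappa X (proPow z α) := by
  choose f hf using exists_coe_eq z
  choose m hm using proPow_eq_spow z α
  refine of_isLim_spow hn hz (IsLim.of_le (g := id) (fun _ => le_rfl) hf)
    (IsLim.of_le (g := id) (fun _ => le_rfl) (f := fun c => _root_.spow (f c) (m c)) fun c => ?_)
  change ((_root_.spow (f c) (m c) : FreeSemigroup X) : c.1.Quotient) = _
  rw [coe_spow, hf, hm]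
  rfl

/-- Words representing a product `x * y` modulo `splitCon c` factor into words representing `x`
and `y` modulo `c`. -/
theorem exists_factorization {x y w : freePro (burnsideBar n) X} (h : w = x * y)
    {g : VCon (burnsideBar n) X → VCon (burnsideBar n) X}
    (hg : ∀ c, (g c).1 = splitCon c.1) {f : VCon (burnsideBar n) X → FreeSemigroup X}
    (hf : ∀ c, (f c : (g c).1.Quotient) = w.1 (g c)) :
    ∃ a b : VCon (burnsideBar n) X → FreeSemigroup X,
      (∀ c, f c = a c * b c) ∧ IsLim a x ∧ IsLim b y := by
  have key : ∀ c, ∃ a b : FreeSemigroup X, f c = a * b ∧ (a : c.1.Quotient) = x.1 c ∧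
      (b : c.1.Quotient) = y.1 c := by
    intro c
    have hle : g c ≤ c := by
      change (g c).1 ≤ c.1
      rw [hg]; exact splitCon_le _
    obtain ⟨u, hu⟩ := exists_coe_eq x (g c)
    obtain ⟨v, hv⟩ := exists_coe_eq y (g c)
    have h1 : (f c : (g c).1.Quotient) = ((u * v : FreeSemigroup X) : (g c).1.Quotient) := by
      rw [hf, h, Con.coe_mul, hu, hv]; rfl
    rw [Con.eq, hg] at h1
    -- The word `u * v` has a visible cut; congruence modulo `splitCon` transports it to `f c`.
    obtain ⟨a, b, hab, ha, hb⟩ := h1.2.2 u v rfl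
    refine ⟨a, b, hab, ?_, ?_⟩
    · rw [x.2 (g c) c hle u hu.symm, Con.eq]; exact c.1.symm ha
    · rw [y.2 (g c) c hle v hv.symm, Con.eq]; exact c.1.symm hb
  choose a b hab ha hb using key
  exact ⟨a, b, hab, .of_le (g := id) (fun _ => le_rfl) ha, .of_le (g := id) (fun _ => le_rfl) hb⟩

/-- The alphabet may be empty; the nonemptiness needed for choice is drawn from one of the given
witnesses. -/
theorem exists_eventually_of_eventually_exists {ι : Type*} {l : Ultrafilter ι}
    {P : ι → FreeSemigroup X → Prop} (h : ∀ᶠ i in (l : Filter ι), ∃ u, P i u) :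
    ∃ u : ι → FreeSemigroup X, ∀ᶠ i in (l : Filter ι), P i (u i) := by
  obtain ⟨i, u, _⟩ := h.exists
  have : Nonempty (FreeSemigroup X) := ⟨u⟩
  exact Filter.skolem.1 h

theorem IsSigmaWord.of_eq_mul (hn : 0 < n) {w : freePro (burnsideBar n) X}
    (hw : IsSigmaWord (burnsideBar n) kappa X w) : ∀ x y, w = x * y →
    IsSigmaWord (burnsideBar n) kappa X x ∧ IsSigmaWord (burnsideBar n) kappa X y := by
  let g : VCon (burnsideBar n) X → VCon (burnsideBar n) X :=
    fun c => ⟨splitCon c.1, burnsideBar_splitCon c.2⟩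
  have hg : ∀ c, g c ≤ c := fun c => splitCon_le c.1
  induction hw with
  | of a =>
    intro x y h
    obtain ⟨u, v, huv, -⟩ := exists_factorization h (g := g) (fun _ => rfl)
      (f := fun _ => FreeSemigroup.of a) fun _ => rfl
    exact (FreeSemigroup.of_ne_mul a _ _ (huv nonempty_vCon.some)).elim
  | mul z t hz ht ihz iht =>
    intro x y h
    choose p hp using fun c => exists_coe_eq z (g c)
    choose q hq using fun c => exists_coe_eq t (g c)
    have hpl : IsLim p z := .of_le hg hp
    have hql : IsLim q t := .of_le hg hq
    obtain ⟨a, b, hab, ha, hb⟩ := exists_factorization h (g := g) (fun _ => rfl)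
      (f := fun c => p c * q c) fun c => by
        rw [Con.coe_mul, hp, hq]; rfl
    have hcase := Eventually.of_forall (f := (fineUltrafilter (burnsideBar n) X : Filter _))
      fun c => FreeSemigroup.mul_eq_mul_iff_exists (hab c)
    rcases Ultrafilter.eventually_or.1 hcase with hcase | hcase
    · rw [← hpl.unique (ha.congr (hcase.mono fun i hi => hi.1.symm)),
        ← hql.unique (hb.congr (hcase.mono fun i hi => hi.2.symm))]
      exact ⟨hz, ht⟩
    rcases Ultrafilter.eventually_or.1 hcase with hcase | hcase
    -- The cut lies inside the words for z: with s the limit of the overlaps, z = x * s and y = s *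
    -- t.
    · obtain ⟨u, hu⟩ := exists_eventually_of_eventually_exists hcase
      obtain ⟨s, hs⟩ := exists_isLim u
      have h1 := hpl.unique ((ha.mul hs).congr (hu.mono fun i hi => hi.1.symm))
      have h2 := hb.unique ((hs.mul hql).congr (hu.mono fun i hi => hi.2.symm))
      have h3 := ihz _ _ h1
      exact ⟨h3.1, h2 ▸ .mul _ _ h3.2 ht⟩
    · obtain ⟨u, hu⟩ := exists_eventually_of_eventually_exists hcase
      obtain ⟨s, hs⟩ := exists_isLim u
      have h1 := ha.unique ((hpl.mul hs).congr (hu.mono fun i hi => hi.1.symm))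
      have h2 := hql.unique ((hs.mul hb).congr (hu.mono fun i hi => hi.2.symm))
      have h3 := iht _ _ h2
      exact ⟨h1 ▸ .mul _ _ hz h3.1, h3.2⟩
  | pow z α _ hz ih =>
    intro x y h
    choose p hp using fun c => exists_coe_eq z (g c)
    choose m hm using fun c => proPow_eq_spow z α (g c)
    have hpl : IsLim p z := .of_le hg hp
    -- The number of full periods left by a cut varies with the congruence, so such a piece is a
    -- limit of powers and need not be a fixed power of z.
    have hpow : ∀ (r : VCon (burnsideBar n) X → ℕ) (s : freePro (burnsideBar n) X),
        IsLim (fun i => _root_.spow (p i) (r i)) s → IsSigmaWord (burnsideBar n) kappa X s :=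
      fun r s hs => of_isLim_spow hn hz hpl hs
    obtain ⟨a, b, hab, ha, hb⟩ := exists_factorization h (g := g) (fun _ => rfl)
      (f := fun c => _root_.spow (p c) (m c)) fun c => by
        rw [coe_spow, hp, hm]
    constructor
    · have hcase := Eventually.of_forall (f := (fineUltrafilter (burnsideBar n) X : Filter _))
        fun c => FreeSemigroup.prefix_spow (hab c)
      rcases Ultrafilter.eventually_or.1 hcase with hcase | hcase
      · obtain ⟨r, hr⟩ := Filter.skolem.1 hcase
        exact hpow r x (ha.congr hr)
      rcases Ultrafilter.eventually_or.1 hcase with hcase | hcase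
      · obtain ⟨u, hu⟩ := exists_eventually_of_eventually_exists hcase
        obtain ⟨v, hv⟩ := exists_eventually_of_eventually_exists hu
        obtain ⟨t, ht⟩ := exists_isLim v
        have h1 := ha.congr (hv.mono fun i hi => hi.2)
        exact (ih _ _ (hpl.unique ((h1.mul ht).congr (hv.mono fun i hi => hi.1)))).1
      -- The prefix is a power of p followed by a proper prefix of p; the three sequences of words
      -- get separate limits e, s, t, with z = s * t and x = e * s.
      · obtain ⟨r, hr⟩ := Filter.skolem.1 hcase
        obtain ⟨u, hu⟩ := exists_eventually_of_eventually_exists hr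
        obtain ⟨v, hv⟩ := exists_eventually_of_eventually_exists hu
        obtain ⟨s, hs⟩ := exists_isLim u
        obtain ⟨t, ht⟩ := exists_isLim v
        obtain ⟨e, he⟩ := exists_isLim fun i => _root_.spow (p i) (r i)
        have h1 := hpl.unique ((hs.mul ht).congr (hv.mono fun i hi => hi.1))
        have h2 := ha.unique ((he.mul hs).congr (hv.mono fun i hi => hi.2.symm))
        exact h2 ▸ .mul _ _ (hpow r e he) (ih _ _ h1).1
    · have hcase := Eventually.of_forall (f := (fineUltrafilter (burnsideBar n) X : Filter _))
        fun c => FreeSemigroup.suffix_spow (hab c)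
      rcases Ultrafilter.eventually_or.1 hcase with hcase | hcase
      · obtain ⟨r, hr⟩ := Filter.skolem.1 hcase
        exact hpow r y (hb.congr hr)
      rcases Ultrafilter.eventually_or.1 hcase with hcase | hcase
      · obtain ⟨u, hu⟩ := exists_eventually_of_eventually_exists hcase
        obtain ⟨v, hv⟩ := exists_eventually_of_eventually_exists hu
        obtain ⟨t, ht⟩ := exists_isLim u
        have h1 := hb.congr (hv.mono fun i hi => hi.2)
        exact (ih _ _ (hpl.unique ((ht.mul h1).congr (hv.mono fun i hi => hi.1)))).2
      · obtain ⟨r, hr⟩ := Filter.skolem.1 hcase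
        obtain ⟨u, hu⟩ := exists_eventually_of_eventually_exists hr
        obtain ⟨v, hv⟩ := exists_eventually_of_eventually_exists hu
        obtain ⟨s, hs⟩ := exists_isLim u
        obtain ⟨t, ht⟩ := exists_isLim v
        obtain ⟨e, he⟩ := exists_isLim fun i => _root_.spow (p i) (r i)
        have h1 := hpl.unique ((hs.mul ht).congr (hv.mono fun i hi => hi.1))
        have h2 := hb.unique ((ht.mul he).congr (hv.mono fun i hi => hi.2.symm))
        exact h2 ▸ .mul _ _ (ih _ _ h1).2 (hpow r e he)

theorem isFactorial_burnsideBar (hn : 0 < n) : IsFactorial (burnsideBar n) kappa := by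
  rintro X _ u w hw (rfl | ⟨a, rfl⟩ | ⟨b, rfl⟩ | ⟨a, b, rfl⟩)
  · exact hw
  · exact (hw.of_eq_mul hn _ _ rfl).2
  · exact (hw.of_eq_mul hn _ _ rfl).1
  · exact ((hw.of_eq_mul hn _ _ rfl).1.of_eq_mul hn _ _ rfl).2

/-! ### Comparison of the two signatures, and the aperiodic case. -/

theorem omegaPred_mem_oneBar : omegaPred ∈ oneBar := by
  rintro ⟨w, hw⟩
  -- If ω - 1 were a positive integer ℓ = `w.tail.length + 1`, a generator t of the cyclic group of
  -- order ℓ + 2 would satisfy t ^ ℓ = t⁻¹, that is t ^ (ℓ + 1) = 1, which is impossible.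
  let t : Multiplicative (ZMod (w.tail.length + 3)) := Multiplicative.ofAdd 1
  have hord : orderOf t = w.tail.length + 3 := by
    rw [orderOf_ofAdd_eq_addOrderOf, ZMod.addOrderOf_one]
  obtain ⟨k, hk1, hk2⟩ :=
    ((evalOp_omegaPred t).and (eventually_ge_atTop (w.tail.length + 3))).exists
  have h1 : evalOp omegaPred t = FreeSemigroup.lift (fun _ : Unit => t) w := by
    rw [← hw]; rfl
  have hfac := Nat.self_le_factorial (k + 2)
  have hdvd : orderOf t ∣ Nat.factorial (k + 2) := by
    rw [hord]
    exact Nat.dvd_factorial (by omega) (by omega)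
  rw [hk1, FreeSemigroup.lift_unit_eq_spow, spow_group, spow_group] at h1
  have h2 : t ^ (w.tail.length + 2) = 1 := by
    rw [pow_succ, ← h1, ← pow_succ,
      show Nat.factorial (k + 2) - 2 + 1 + 1 = Nat.factorial (k + 2) by omega]
    exact orderOf_dvd_iff_pow_eq_one.1 hdvd
  have h3 := Nat.le_of_dvd (by omega) (orderOf_dvd_of_pow_eq_one h2)
  omega

theorem isSigmaWord_kappa_iff_oneBar (hn : 0 < n) (x : freePro (burnsideBar n) X) :
    IsSigmaWord (burnsideBar n) kappa X x ↔ IsSigmaWord (burnsideBar n) oneBar X x := by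
  constructor <;> intro h
  · induction h with
    | of a => exact .of a
    | mul x y _ _ hx hy => exact .mul _ _ hx hy
    | pow x α hα _ hx =>
      obtain rfl : α = omegaPred := hα
      exact .pow _ _ omegaPred_mem_oneBar hx
  · induction h with
    | of a => exact .of a
    | mul x y _ _ hx hy => exact .mul _ _ hx hy
    | pow x α _ _ hx => exact hx.proPow hn α

theorem Pseudovariety.ext {V W : Pseudovariety}
    (h : ∀ (S : Type) [Semigroup S], V.Mem S ↔ W.Mem S) : V = W := by
  obtain ⟨M, _, _, _, _, _⟩ := V
  obtain ⟨N, _, _, _, _, _⟩ := W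
  obtain rfl : @M = @N := by
    funext S _
    exact propext (h S)
  rfl

theorem aperiodic_eq_burnsideBar_one : aperiodic = burnsideBar 1 :=
  Pseudovariety.ext fun S _ => subgroupsIn_subsingleton_iff S

end Words

theorem corollary2p3 :
    (∀ n : ℕ, 0 < n →
      IsFactorial (burnsideBar n) kappa ∧
      ∀ (X : Type) [Finite X] (x : freePro (burnsideBar n) X),
        IsSigmaWord (burnsideBar n) kappa X x ↔ IsSigmaWord (burnsideBar n) oneBar X x) ∧
    IsFactorial aperiodic kappa :=
  ⟨fun _ hn => ⟨isFactorial_burnsideBar hn, fun _ _ x => isSigmaWord_kappa_iff_oneBar hn x⟩,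
    aperiodic_eq_burnsideBar_one ▸ isFactorial_burnsideBar one_pos⟩
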